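/- Let $n\ge b\ge 2$ and $D\ge 1$ be integers, write $[q]=\{0,1,\dots,q-1\}$, and for a vector $\mathbf x=(x_0,\dots,x_{d-1})$ of integers put $[\mathbf x]_q=\sum_{t=0}^{d-1}x_tq^t$. Let $p$ be the smallest prime with $p\ge 2b+1$ and let $s=\lceil\log_p(D+1)\rceil$. Let $\xi_0,\dots,\xi_{D-1}\in\mathbb F_{p^s}$ be distinct and let $$C_L=\Big\{\mathbf c\in\mathbb F_p^D : \sum_{t=0}^{D-1}c_t\,\xi_t^{\,j}=0\ \text{ for all } 0\le j\le b-1\Big\}$$ (with $\xi^0=1$) be the corresponding BCH code over $\mathbb F_p$. Let $r=D-\dim C_L$, and let $A$ be an $r\times D$ matrix over $\mathbb F_p$ whose kernel is $C_L$. Define $$m=\lceil\log_2(n^D+1)\rceil,\qquad a=\lceil\log_2(p^{r}+1)\rceil,\qquad a'=\lceil\log_2(p^D+1)\rceil,$$ assume $\gcd(p,2^m-1)=1$, and let $\alpha\in\mathbb F_{2^m}$, $\beta\in\mathbb F_{2^a}$, $\gamma\in\mathbb F_{2^{a'}}$ be primitive elements (generators of the multiplicative groups). Let $H$ be the binary matrix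 whose columns are indexed by $\mathbf i\in[np]^D$ and whose $\mathbf i$-th column is $$\mathbf h_{\mathbf i}^\intercal=\begin{pmatrix}\beta^{[A\mathbf i^\intercal \bmod p]_p}\\ \beta^{3[A\mathbf i^\intercal \bmod p]_p}\\ \lfloor \mathbf i^\intercal/p\rfloor \bmod 2\\ \gamma^{[\mathbf i\bmod p]_p}\\ \alpha^{[\mathbf i]_n}\end{pmatrix},$$ where $\lfloor\cdot/p\rfloor$ and $\bmod$ act entrywise and each element of $\mathbb F_{2^k}$ is written as $k$ binary entries by means of an $\mathbb F_2$-linear isomorphism $\mathbb F_{2^k}\cong\mathbb F_2^k$ (fixed for each of the three fields). Let $C=\ker H$. Then $C$ is a binary linear $D$-dimensional code of length $(np)^{\times D}$, that is, an $[N,k]$ code with $N=(np)^D$ and some dimension $k$, and it is capable of correcting a single $2$-weight-limited $b$-burst in the $L_1$ model. Namely, let $E$ be the set of all $\mathbf e\in\mathbb F_2^{[np]^D}$ that either have Hamming weight at most $1$, or have Hamming weight $2$ with the two nonzero positions $\mathbf i\ne\mathbf j$ satisfying $\sum_{t=0}^{D-1}|i_t-j_t|<b$. Then there is a decoding map $\mathrm{dec}:\mathbb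 F_2^{[np]^D}\to\mathbb F_2^{[np]^D}$ such that $\mathrm{dec}(\mathbf c+\mathbf e)=\mathbf c$ for all $\mathbf c\in C$ and $\mathbf e\in E$. -/

import Mathlib

namespace BurstCode

/-- Positions of a `D`-dimensional array of side `N`. -/
abbrev Pos (N D : ℕ) : Type := Fin D → Fin N

/-- Binary `D`-dimensional arrays of side `N`. -/
abbrev Arr (N D : ℕ) : Type := Pos N D → ZMod 2

/-- Two positions are `b`-close in the `L₁` model. -/
def IsCloseL1 {N D : ℕ} (b : ℕ) (i j : Pos N D) : Prop :=
  ∑ t, |((i t : ℕ) : ℤ) - ((j t : ℕ) : ℤ)| < (b : ℤ)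

/-- The `2`-weight-limited `b`-bursts in the `L₁` model. -/
def burstsL1 (N D b : ℕ) : Set (Arr N D) :=
  {e | hammingNorm e ≤ 1 ∨
    (hammingNorm e = 2 ∧ ∃ i j, i ≠ j ∧ e i = 1 ∧ e j = 1 ∧ IsCloseL1 b i j)}

/-- `C` corrects the error patterns in `E`: some decoder recovers every codeword `c` from
`c + e`, for every error pattern `e` in `E`. -/
def Corrects {ι : Type*} (C : Submodule (ZMod 2) (ι → ZMod 2)) (E : Set (ι → ZMod 2)) : Prop :=
  ∃ dec : (ι → ZMod 2) → (ι → ZMod 2), ∀ c ∈ C, ∀ e ∈ E, dec (c + e) = c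

/-- `C` is an `[N, k]` linear code. -/
def HasParameters {F ι : Type*} [Field F] [Fintype ι] (C : Submodule F (ι → F)) (N k : ℕ) :
    Prop :=
  Fintype.card ι = N ∧ Module.finrank F C = k

/-- The redundancy: length minus dimension. -/
noncomputable def redundancy {F ι : Type*} [Field F] [Fintype ι] (C : Submodule F (ι → F)) : ℕ :=
  Fintype.card ι - Module.finrank F C

/-- The linear code whose parity-check matrix is `H`, i.e. the kernel of `H`. -/
def codeOf {F κ ι : Type*} [Field F] [Fintype ι] (H : Matrix κ ι F) : Submodule F (ι → F) :=
  LinearMap.ker H.mulVecLin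

/-- A primitive element of a field: a generator of its multiplicative group. -/
def IsPrimitiveElement {K : Type*} [Field K] (x : K) : Prop :=
  ∃ u : Kˣ, (u : K) = x ∧ ∀ v : Kˣ, v ∈ Subgroup.zpowers u

/-- `[x]_q = ∑ t, x_t q ^ t`. -/
def baseVal {D : ℕ} (q : ℕ) (x : Fin D → ℕ) : ℕ := ∑ t, x t * q ^ (t : ℕ)

/-- The matrix over `K` with rows `1, ξ, ξ², …, ξ^(b-1)` (entrywise powers). -/
def bchMatrix {K : Type*} [Field K] {D : ℕ} (b : ℕ) (ξ : Fin D → K) : Matrix (Fin b) (Fin D) K :=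
  Matrix.of fun j t => ξ t ^ (j : ℕ)

/-- The BCH code over `𝔽_p` of length `D` with locators `ξ` in an extension field `K`: the words
over `𝔽_p` that lie in the kernel of `bchMatrix b ξ`. -/
def bchCode (p : ℕ) [Fact p.Prime] {K : Type*} [Field K] [Algebra (ZMod p) K] {D : ℕ} (b : ℕ)
    (ξ : Fin D → K) : Submodule (ZMod p) (Fin D → ZMod p) where
  carrier := {c | (bchMatrix b ξ).mulVec (fun t => algebraMap (ZMod p) K (c t)) = 0}
  zero_mem' := by
    ext j
    simp [Matrix.mulVec, dotProduct]
  add_mem' := by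
    intro x y hx hy
    have h : (fun t => algebraMap (ZMod p) K ((x + y) t)) =
        (fun t => algebraMap (ZMod p) K (x t)) + fun t => algebraMap (ZMod p) K (y t) := by
      ext t
      simp
    simp only [Set.mem_ofPred_eq] at hx hy ⊢
    rw [h, Matrix.mulVec_add, hx, hy, add_zero]
  smul_mem' := by
    intro r x hx
    have h : (fun t => algebraMap (ZMod p) K ((r • x) t)) =
        algebraMap (ZMod p) K r • fun t => algebraMap (ZMod p) K (x t) := by
      ext t
      simp
    simp only [Set.mem_ofPred_eq] at hx ⊢
    rw [h, Matrix.mulVec_smul, hx, smul_zero]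

/-- `[A iᵀ mod p]_p`. -/
def syndromeVal {p r D N : ℕ} (A : Matrix (Fin r) (Fin D) (ZMod p)) (i : Pos N D) : ℕ :=
  baseVal p fun l => (A.mulVec (fun t => ((i t : ℕ) : ZMod p)) l).val

/-- The binary parity-check matrix of the construction, with five layers of rows. The column at
`i` is `β^[Ai mod p]_p`, `β^(3[Ai mod p]_p)`, `⌊i/p⌋ mod 2`, `γ^[i mod p]_p`, `α^[i]_n`, where an
element of `𝔽_{2^k}` is expanded into `k` binary rows by the given isomorphism with `𝔽₂^k`. -/
noncomputable def parityCheckL1 {n p D r m a a' : ℕ}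
    (A : Matrix (Fin r) (Fin D) (ZMod p))
    (α : GaloisField 2 m) (β : GaloisField 2 a) (γ : GaloisField 2 a')
    (φm : GaloisField 2 m ≃ₗ[ZMod 2] (Fin m → ZMod 2))
    (φa : GaloisField 2 a ≃ₗ[ZMod 2] (Fin a → ZMod 2))
    (φa' : GaloisField 2 a' ≃ₗ[ZMod 2] (Fin a' → ZMod 2)) :
    Matrix (Fin a ⊕ Fin a ⊕ Fin D ⊕ Fin a' ⊕ Fin m) (Pos (n * p) D) (ZMod 2) :=
  Matrix.of fun row i =>
    Sum.elim (φa (β ^ syndromeVal A i))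
      (Sum.elim (φa (β ^ (3 * syndromeVal A i)))
        (Sum.elim (fun t => (((i t : ℕ) / p : ℕ) : ZMod 2))
          (Sum.elim (φa' (γ ^ baseVal p fun t => (i t : ℕ) % p))
            (φm (α ^ baseVal n fun t => (i t : ℕ)))))) row

end BurstCode

/-!
A nonzero integer vector of `L₁` norm less than `2 * b` cannot satisfy the BCH checks modulo `p`:
its positive and negative parts give two multisets of locators, of the same size less than `b` and
with the same first `b - 1` power sums, so Newton's identities, valid since `b ≤ p`, make the
multisets equal. Hence the BCH code over `ℤ / p` has minimum Lee distance at least `2 * b`.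

Suppose two bursts have the same syndrome. The powers `β ^ s` and `β ^ (3 * s)` are the checks of a
binary code correcting two errors, so the bursts have the same set of inner syndromes `A i mod p`.
The displacement between the two positions of a burst has `L₁` norm less than `b`, so by the Lee
distance the inner syndromes determine it, and one burst is a translate of the other. The parities
of the quotients by `p` then force the residues modulo `p` to be translated as well. A sum of
powers of `γ` over a translated family is the original sum, which is nonzero, times a power of `γ`;
hence the checks in `γ` show that the residues agree. For the same reason the checks in `α` show
that `[i]_n` and `[j]_n` agree modulo the order of `α` for corresponding positions `i` and `j`.
Since `i - j` is divisible by `p`, which is coprime to that order, the quotients agree too.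
-/

namespace BurstCode

open Finset

open scoped Nat

/-! ### Power sums and Newton's identities -/

section PowerSums

variable {R : Type*} [CommRing R]

theorem mul_multiset_esymm_eq_sum (S : Multiset R) (k : ℕ) :
    k * S.esymm k = (-1) ^ (k + 1) *
      ∑ a ∈ antidiagonal k with a.1 < k, (-1) ^ a.1 * S.esymm a.1 * (S.map (· ^ a.2)).sum := by
  classical
  have newton := congrArg (MvPolynomial.aeval fun x : S => (x : R))
    (MvPolynomial.mul_esymm_eq_sum S R k)
  have hpsum (j : ℕ) : ∑ x : S, (x : R) ^ j = (S.map (· ^ j)).sum :=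
    congrArg Multiset.sum (Multiset.map_univ S (· ^ j))
  simpa only [map_mul, map_pow, map_neg, map_one, map_sum, map_natCast, MvPolynomial.psum,
    MvPolynomial.aeval_X, MvPolynomial.aeval_esymm_eq_multiset_esymm, Multiset.map_univ_coe,
    hpsum] using newton

variable [IsDomain R] {S T : Multiset R}

theorem esymm_eq_of_sum_pow_eq {N : ℕ} (hN : (N ! : R) ≠ 0)
    (h : ∀ k, 0 < k → k ≤ N → (S.map (· ^ k)).sum = (T.map (· ^ k)).sum) {k : ℕ} (hk : k ≤ N) :
    S.esymm k = T.esymm k := by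
  induction k using Nat.strong_induction_on with
  | _ k ih =>
    rcases k.eq_zero_or_pos with rfl | hpos
    · simp only [Multiset.esymm, Multiset.powersetCard_zero_left]
    have hk0 : (k : R) ≠ 0 :=
      ne_zero_of_dvd_ne_zero hN (Nat.cast_dvd_cast (Nat.dvd_factorial hpos hk))
    refine mul_left_cancel₀ hk0 ?_
    rw [mul_multiset_esymm_eq_sum, mul_multiset_esymm_eq_sum]
    congr 1
    refine sum_congr rfl fun a ha => ?_
    obtain ⟨hanti, hlt⟩ := mem_filter.1 ha
    have hsum := mem_antidiagonal.1 hanti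
    rw [ih a.1 hlt (by omega), h a.2 (by omega) (by omega)]

theorem multiset_eq_of_sum_pow_eq (hcard : S.card = T.card) (hfact : (S.card ! : R) ≠ 0)
    (h : ∀ k, 0 < k → k ≤ S.card → (S.map (· ^ k)).sum = (T.map (· ^ k)).sum) : S = T := by
  have hprod : (S.map fun x => Polynomial.X - Polynomial.C x).prod =
      (T.map fun x => Polynomial.X - Polynomial.C x).prod := by
    rw [Multiset.prod_X_sub_X_eq_sum_esymm, Multiset.prod_X_sub_X_eq_sum_esymm, ← hcard]
    refine sum_congr rfl fun k hk => ?_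
    rw [esymm_eq_of_sum_pow_eq hfact h (Nat.lt_succ_iff.1 (mem_range.1 hk))]
  simpa only [Polynomial.roots_multiset_prod_X_sub_C] using congrArg Polynomial.roots hprod

theorem multiplicities_eq_of_sum_mul_pow_eq {ι : Type*} [Fintype ι] {ξ : ι → R}
    (hξ : Function.Injective ξ) {u v : ι → ℕ} (hcard : ∑ t, u t = ∑ t, v t)
    (hfact : ((∑ t, u t)! : R) ≠ 0)
    (h : ∀ k, 0 < k → k ≤ ∑ t, u t → ∑ t, (u t : R) * ξ t ^ k = ∑ t, (v t : R) * ξ t ^ k) :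
    u = v := by
  classical
  let roots (w : ι → ℕ) : Multiset R := ∑ t, w t • {ξ t}
  have hroots_card (w : ι → ℕ) : (roots w).card = ∑ t, w t := by simp [roots]
  have hroots_sum (w : ι → ℕ) (k : ℕ) :
      ((roots w).map (· ^ k)).sum = ∑ t, (w t : R) * ξ t ^ k := by
    simp only [roots, ← Multiset.coe_mapAddMonoidHom, ← Multiset.coe_sumAddMonoidHom, map_sum]
    simp [Multiset.map_nsmul, Multiset.sum_nsmul]
  have hroots_count (w : ι → ℕ) (t : ι) : (roots w).count (ξ t) = w t := by
    simp [roots, Multiset.count_sum', Multiset.count_nsmul, Multiset.count_singleton, hξ.eq_iff]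
  have hroots : roots u = roots v := by
    refine multiset_eq_of_sum_pow_eq ?_ ?_ fun k hk hku => ?_
    · rw [hroots_card, hroots_card, hcard]
    · rwa [hroots_card]
    · rw [hroots_sum, hroots_sum]
      exact h k hk (hku.trans_eq (hroots_card u))
  funext t
  rw [← hroots_count u, hroots, hroots_count]

end PowerSums

/-! ### The minimum Lee distance of a BCH code -/

theorem eq_zero_of_sum_mul_pow_eq_zero {R ι : Type*} [CommRing R] [IsDomain R] [Fintype ι]
    {p b : ℕ} [Fact p.Prime] [CharP R p] (hp : 2 * b ≤ p) {ξ : ι → R}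
    (hξ : Function.Injective ξ) {c : ι → ℤ} (hc : ∑ t, |c t| < 2 * b)
    (h : ∀ k < b, ∑ t, (c t : R) * ξ t ^ k = 0) : c = 0 := by
  let u (t : ι) : ℕ := (c t).toNat
  let v (t : ι) : ℕ := (-c t).toNat
  have hsub (t : ι) : c t = (u t : ℤ) - v t := by grind
  have habs (t : ι) : |c t| = (u t : ℤ) + v t := by grind
  have hbound : ∑ t, u t + ∑ t, v t < 2 * b := by
    zify
    simpa only [← sum_add_distrib, ← habs] using hc
  have hpow (k : ℕ) (hk : k < b) : ∑ t, (u t : R) * ξ t ^ k = ∑ t, (v t : R) * ξ t ^ k := by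
    rw [← sub_eq_zero, ← sum_sub_distrib, ← h k hk]
    refine sum_congr rfl fun t _ => ?_
    rw [hsub t]
    push_cast
    ring
  have hcard : ∑ t, u t = ∑ t, v t := by
    have hmod := hpow 0 (by omega)
    simp only [pow_zero, mul_one, ← Nat.cast_sum] at hmod
    exact ((CharP.natCast_eq_natCast R p).1 hmod).eq_of_lt_of_lt (by omega) (by omega)
  have hfact : ((∑ t, u t)! : R) ≠ 0 := by
    rw [Ne, CharP.cast_eq_zero_iff R p, (Fact.out : p.Prime).dvd_factorial]
    omega
  have huv : u = v :=
    multiplicities_eq_of_sum_mul_pow_eq hξ hcard hfact fun k _ hk => hpow k (by omega)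
  funext t
  rw [hsub, huv, sub_self, Pi.zero_apply]

/-- The code over `ℤ / p` with parity-check matrix `A` has minimum Lee distance at least `w`. The
Lee weight of a residue vector is the smallest `L₁` norm of an integer vector lifting it, so the
condition is put on integer vectors. -/
def LeeDistanceAtLeast {p : ℕ} {κ ι : Type*} [Fintype ι] (A : Matrix κ ι (ZMod p)) (w : ℕ) :
    Prop :=
  ∀ c : ι → ℤ, ∑ t, |c t| < w → A.mulVec (fun t => (c t : ZMod p)) = 0 → c = 0

theorem leeDistanceAtLeast_of_codeOf_eq_bchCode {p b D : ℕ} [Fact p.Prime] (hp : 2 * b ≤ p)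
    {K κ : Type*} [Field K] [Algebra (ZMod p) K] {ξ : Fin D → K} (hξ : Function.Injective ξ)
    {A : Matrix κ (Fin D) (ZMod p)} (hA : codeOf A = bchCode p b ξ) :
    LeeDistanceAtLeast A (2 * b) := by
  intro c hc hAc
  have hmem : (fun t => (c t : ZMod p)) ∈ bchCode p b ξ := hA ▸ hAc
  have : CharP K p := charP_of_injective_algebraMap (algebraMap (ZMod p) K).injective p
  refine eq_zero_of_sum_mul_pow_eq_zero (R := K) hp hξ (by exact_mod_cast hc) fun k hk => ?_
  have hcheck := congrFun (show (bchMatrix b ξ).mulVec _ = 0 from hmem) ⟨k, hk⟩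
  simpa [Matrix.mulVec, dotProduct, bchMatrix, mul_comm] using hcheck

/-! ### Odd power sums in characteristic two -/

section CharTwo

variable {K : Type*} [Field K] [CharP K 2]

theorem sum_pow_eq_zero_of_odd {U : Finset K} {t : ℕ}
    (h : ∀ k < 2 * t, Odd k → ∑ x ∈ U, x ^ k = 0) {k : ℕ} (hk0 : 0 < k) (hk : k ≤ 2 * t) :
    ∑ x ∈ U, x ^ k = 0 := by
  induction k using Nat.strong_induction_on with
  | _ k ih =>
    rcases k.even_or_odd' with ⟨j, rfl | rfl⟩
    · simp only [mul_comm 2 j, pow_mul, ← CharTwo.sum_sq]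
      rw [ih j (by omega) (by omega) (by omega), zero_pow two_ne_zero]
    · exact h _ (by omega) (odd_two_mul_add_one j)

/-- The BCH bound for the narrow-sense binary code with designed distance `2 * t + 1`. -/
theorem eq_empty_of_sum_odd_pow_eq_zero {U : Finset K} {t : ℕ} (h0 : 0 ∉ U) (hU : #U ≤ 2 * t)
    (h : ∀ k < 2 * t, Odd k → ∑ x ∈ U, x ^ k = 0) : U = ∅ := by
  let f (l : Fin #U) : K := U.equivFin.symm l
  have hf : Function.Injective f := Subtype.val_injective.comp U.equivFin.symm.injective
  have hvandermonde (k : Fin #U) : ∑ l, f l * f l ^ (k : ℕ) = 0 := by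
    rw [← sum_pow_eq_zero_of_odd h k.val.succ_pos (by omega), ← sum_coe_sort U,
      ← U.equivFin.symm.sum_comp]
    exact sum_congr rfl fun l _ => (pow_succ' _ _).symm
  have hzero := Matrix.eq_zero_of_forall_pow_sum_mul_pow_eq_zero hf hvandermonde
  refine eq_empty_of_forall_notMem fun x hx => h0 ?_
  have hfx : f (U.equivFin ⟨x, hx⟩) = x := by simp [f]
  rwa [← hfx, congrFun hzero, Pi.zero_apply] at hx

theorem eq_of_sum_odd_pow_eq {S T : Finset K} {t : ℕ} (hS0 : 0 ∉ S) (hT0 : 0 ∉ T) (hS : #S ≤ t)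
    (hT : #T ≤ t) (h : ∀ k < 2 * t, Odd k → ∑ x ∈ S, x ^ k = ∑ x ∈ T, x ^ k) : S = T := by
  classical
  rw [← symmDiff_eq_bot, bot_eq_empty]
  refine eq_empty_of_sum_odd_pow_eq_zero (t := t) (by simp [mem_symmDiff, hS0, hT0]) ?_
    fun k hk hodd => ?_
  · have hcard : #(symmDiff S T) ≤ #(S ∪ T) := card_le_card symmDiff_le_sup
    have hunion := card_union_le S T
    omega
  · rw [symmDiff_def, sup_eq_union, sum_union disjoint_sdiff_sdiff, ← CharTwo.sub_eq_add,
      sum_sdiff_sub_sum_sdiff, h k hk hodd, sub_self]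

variable {ι : Type*} {S T : Finset ι} {f : ι → K}

theorem sum_ne_zero_of_card_le_two (hS : S.Nonempty) (hcard : #S ≤ 2) (hf : Set.InjOn f S)
    (hf0 : ∀ i, f i ≠ 0) : ∑ i ∈ S, f i ≠ 0 := by
  classical
  intro hsum
  refine (hS.image f).ne_empty (eq_empty_of_sum_odd_pow_eq_zero (t := 1) ?_ ?_ fun k hk hodd => ?_)
  · simp [hf0]
  · exact card_image_le.trans hcard
  · obtain rfl : k = 1 := by grind
    simpa [sum_image hf] using hsum

theorem image_eq_of_sum_eq_of_sum_cube_eq [DecidableEq K] (hS : #S ≤ 2) (hT : #T ≤ 2)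
    (hfS : Set.InjOn f S) (hfT : Set.InjOn f T) (hf0 : ∀ i, f i ≠ 0)
    (h : ∑ i ∈ S, f i = ∑ i ∈ T, f i) (h3 : ∑ i ∈ S, f i ^ 3 = ∑ i ∈ T, f i ^ 3) :
    S.image f = T.image f := by
  refine eq_of_sum_odd_pow_eq (t := 2) ?_ ?_ (card_image_le.trans hS) (card_image_le.trans hT)
    fun k hk hodd => ?_
  · simp [hf0]
  · simp [hf0]
  · rw [sum_image hfS, sum_image hfT]
    obtain rfl | rfl : k = 1 ∨ k = 3 := by grind
    · simpa only [pow_one] using h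
    · exact h3

end CharTwo

/-! ### Exponents written in base `q` -/

section BaseVal

variable {q D : ℕ}

theorem abs_sum_mul_pow_lt {d : Fin D → ℤ} (hd : ∀ t, |d t| < q) :
    |∑ t, d t * (q : ℤ) ^ (t : ℕ)| < (q : ℤ) ^ D := by
  calc |∑ t, d t * (q : ℤ) ^ (t : ℕ)| ≤ ∑ t, |d t * (q : ℤ) ^ (t : ℕ)| := abs_sum_le_sum_abs _ _
    _ ≤ ∑ t : Fin D, ((q : ℤ) - 1) * (q : ℤ) ^ (t : ℕ) := by
      refine sum_le_sum fun t _ => ?_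
      rw [abs_mul, abs_of_nonneg (a := (q : ℤ) ^ (t : ℕ)) (by positivity)]
      gcongr
      exact Int.le_sub_one_of_lt (hd t)
    _ = (q : ℤ) ^ D - 1 := by
      rw [← mul_sum, Fin.sum_univ_eq_sum_range (fun t => (q : ℤ) ^ t), mul_comm, geom_sum_mul]
    _ < (q : ℤ) ^ D := sub_one_lt _

theorem digits_eq_zero_of_sum_mul_pow_eq_zero {d : Fin D → ℤ} (hd : ∀ t, |d t| < q)
    (h : ∑ t, d t * (q : ℤ) ^ (t : ℕ) = 0) : d = 0 := by
  induction D with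
  | zero => exact Subsingleton.elim _ _
  | succ D ih =>
    have hsplit : d 0 + q * ∑ t : Fin D, d t.succ * (q : ℤ) ^ (t : ℕ) = 0 := by
      rw [← h, Fin.sum_univ_succ, mul_sum]
      simp only [Fin.val_zero, pow_zero, mul_one, Fin.val_succ, pow_succ', mul_left_comm]
    have hq : (q : ℤ) ≠ 0 := ((abs_nonneg _).trans_lt (hd 0)).ne'
    have hhead : d 0 = 0 := Int.eq_zero_of_abs_lt_dvd
      ((dvd_add_left (dvd_mul_right _ _)).1 (hsplit ▸ dvd_zero _)) (hd 0)
    rw [hhead, zero_add] at hsplit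
    have htail := ih (fun t => hd t.succ) ((mul_eq_zero.1 hsplit).resolve_left hq)
    exact funext (Fin.cases hhead (congrFun htail))

theorem digits_eq_zero_of_dvd_sum_mul_pow {M : ℕ} (hM : q ^ D ≤ M) {d : Fin D → ℤ}
    (hd : ∀ t, |d t| < q) (h : (M : ℤ) ∣ ∑ t, d t * (q : ℤ) ^ (t : ℕ)) : d = 0 := by
  refine digits_eq_zero_of_sum_mul_pow_eq_zero hd (Int.eq_zero_of_abs_lt_dvd h ?_)
  exact (abs_sum_mul_pow_lt hd).trans_le (by exact_mod_cast hM)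

theorem baseVal_add (u v : Fin D → ℕ) : baseVal q (u + v) = baseVal q u + baseVal q v := by
  simp only [baseVal, Pi.add_apply, add_mul, sum_add_distrib]

theorem baseVal_sub_baseVal (u v : Fin D → ℕ) :
    (baseVal q u : ℤ) - baseVal q v = ∑ t, ((u t : ℤ) - v t) * (q : ℤ) ^ (t : ℕ) := by
  simp only [baseVal, Nat.cast_sum, Nat.cast_mul, Nat.cast_pow, sub_mul, sum_sub_distrib]

theorem orderOf_dvd_of_pow_baseVal_eq {G : Type*} [Monoid G] {x : G} (hx : IsOfFinOrder x)
    {u v : Fin D → ℕ} (h : x ^ baseVal q u = x ^ baseVal q v) :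
    (orderOf x : ℤ) ∣ ∑ t, ((u t : ℤ) - v t) * (q : ℤ) ^ (t : ℕ) := by
  rw [← baseVal_sub_baseVal]
  exact Nat.modEq_iff_dvd.1 (hx.pow_eq_pow_iff_modEq.1 h).symm

theorem eq_of_pow_baseVal_eq {G : Type*} [Monoid G] {x : G} (hx : IsOfFinOrder x)
    (hq : q ^ D ≤ orderOf x) {u v : Fin D → ℕ} (huv : ∀ t, |(u t : ℤ) - v t| < q)
    (h : x ^ baseVal q u = x ^ baseVal q v) : u = v := by
  have hzero := digits_eq_zero_of_dvd_sum_mul_pow hq huv (orderOf_dvd_of_pow_baseVal_eq hx h)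
  funext t
  exact_mod_cast sub_eq_zero.1 (congrFun hzero t)

theorem abs_natCast_sub_lt {x y : ℕ} (hx : x < q) (hy : y < q) : |(x : ℤ) - y| < q := by
  rw [abs_lt]
  omega

theorem eq_of_mod_eq_of_pow_baseVal_eq {G : Type*} [Monoid G] {x : G} (hx : IsOfFinOrder x)
    (hq : q ^ D ≤ orderOf x) {p : ℕ} (hp : p.Coprime (orderOf x)) {u v : Fin D → ℕ}
    (hu : ∀ t, u t < q * p) (hv : ∀ t, v t < q * p) (hmod : ∀ t, u t % p = v t % p)
    (h : x ^ baseVal q u = x ^ baseVal q v) : u = v := by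
  have hsub (t : Fin D) : (u t : ℤ) - v t = p * ((u t / p : ℕ) - (v t / p : ℕ)) := by
    have hu : (p : ℤ) * (u t / p : ℕ) + (u t % p : ℕ) = u t := by
      exact_mod_cast Nat.div_add_mod (u t) p
    have hv : (p : ℤ) * (v t / p : ℕ) + (v t % p : ℕ) = v t := by
      exact_mod_cast Nat.div_add_mod (v t) p
    rw [← hmod t] at hv
    linear_combination hv - hu
  have hdvd := orderOf_dvd_of_pow_baseVal_eq hx h
  simp only [hsub, mul_assoc, ← mul_sum] at hdvd
  have hquot := digits_eq_zero_of_dvd_sum_mul_pow hq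
    (fun t => abs_natCast_sub_lt (Nat.div_lt_of_lt_mul (by simpa only [mul_comm] using hu t))
      (Nat.div_lt_of_lt_mul (by simpa only [mul_comm] using hv t)))
    (((Nat.isCoprime_iff_coprime.2 hp).symm).dvd_of_dvd_mul_left hdvd)
  funext t
  have hzero : (u t : ℤ) - v t = 0 := by rw [hsub t, congrFun hquot t, Pi.zero_apply, mul_zero]
  exact_mod_cast sub_eq_zero.1 hzero

end BaseVal

/-! ### Translated families -/

section Translate

variable {ι : Type*} {S : Finset ι}

theorem pow_eq_pow_of_sum_pow_eq {R : Type*} [CommRing R] [IsDomain R] {x : R} {e e' : ι → ℕ}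
    (hshift : ∀ i ∈ S, ∀ j ∈ S, e i + e' j = e' i + e j) (hne : ∑ i ∈ S, x ^ e i ≠ 0)
    (h : ∑ i ∈ S, x ^ e i = ∑ i ∈ S, x ^ e' i) {j : ι} (hj : j ∈ S) : x ^ e j = x ^ e' j := by
  refine mul_left_cancel₀ hne ?_
  calc (∑ i ∈ S, x ^ e i) * x ^ e j = (∑ i ∈ S, x ^ e' i) * x ^ e j := by rw [h]
    _ = (∑ i ∈ S, x ^ e i) * x ^ e' j := by
      rw [sum_mul, sum_mul]
      exact sum_congr rfl fun i hi => by rw [← pow_add, ← pow_add, hshift i hi j hj]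

theorem pow_baseVal_eq_of_sum_eq {K : Type*} [Field K] [CharP K 2] {x : K} (hx : x ≠ 0)
    {q D : ℕ} {u u' : ι → Fin D → ℕ} (hcard : #S ≤ 2)
    (hinj : Set.InjOn (fun i => x ^ baseVal q (u i)) S)
    (hshift : ∀ i ∈ S, ∀ j ∈ S, ∀ t, u i t + u' j t = u' i t + u j t)
    (h : ∑ i ∈ S, x ^ baseVal q (u i) = ∑ i ∈ S, x ^ baseVal q (u' i)) {j : ι} (hj : j ∈ S) :
    x ^ baseVal q (u j) = x ^ baseVal q (u' j) := by
  refine pow_eq_pow_of_sum_pow_eq (fun i hi j hj => ?_)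
    (sum_ne_zero_of_card_le_two ⟨j, hj⟩ hcard hinj fun i => pow_ne_zero _ hx) h hj
  rw [← baseVal_add, ← baseVal_add]
  exact congrArg (baseVal q) (funext (hshift i hi j hj))

theorem mod_add_mod_eq_of_div_parity {p i j i' j' : ℕ} (hp : 0 < p) (hshift : i + j' = i' + j)
    (hparity : ((i / p : ℕ) : ZMod 2) + (j / p : ℕ) = (i' / p : ℕ) + (j' / p : ℕ)) :
    i % p + j' % p = i' % p + j % p := by
  have hdiv (k : ℕ) : (k : ℤ) = p * (k / p : ℕ) + (k % p : ℕ) := by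
    exact_mod_cast (Nat.div_add_mod k p).symm
  have hlt (k : ℕ) : k % p < p := Nat.mod_lt k hp
  obtain ⟨c, hc⟩ : (2 : ℤ) ∣ (i' / p : ℕ) + (j / p : ℕ) - (i / p : ℕ) - (j' / p : ℕ) := by
    have hmod : (i / p + j / p) % 2 = (i' / p + j' / p) % 2 :=
      (ZMod.natCast_eq_natCast_iff' _ _ 2).1 (by exact_mod_cast hparity)
    omega
  -- Both sides lie in `[0, 2p - 2]`, so being congruent modulo `2p` makes them equal.
  have hdvd : ((2 * p : ℕ) : ℤ) ∣ (i % p + j' % p : ℕ) - (i' % p + j % p : ℕ) := by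
    refine ⟨c, ?_⟩
    have hshift' : (i : ℤ) + j' = i' + j := by exact_mod_cast hshift
    rw [hdiv i, hdiv j, hdiv i', hdiv j'] at hshift'
    push_cast at hshift' hc ⊢
    linear_combination hshift' + p * hc
  have hzero := Int.eq_zero_of_abs_lt_dvd hdvd
    (abs_natCast_sub_lt (by have := hlt i; have := hlt j'; omega)
      (by have := hlt i'; have := hlt j; omega))
  exact_mod_cast sub_eq_zero.1 hzero

theorem mod_add_mod_eq_of_sum_div_eq {p : ℕ} (hp : 0 < p) {u u' : ι → ℕ} (hcard : #S ≤ 2)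
    (hshift : ∀ i ∈ S, ∀ j ∈ S, u i + u' j = u' i + u j)
    (hparity : ∑ i ∈ S, ((u i / p : ℕ) : ZMod 2) = ∑ i ∈ S, ((u' i / p : ℕ) : ZMod 2))
    {i j : ι} (hi : i ∈ S) (hj : j ∈ S) : u i % p + u' j % p = u' i % p + u j % p := by
  classical
  obtain rfl | hij := eq_or_ne i j
  · exact add_comm _ _
  have hpair : {i, j} = S :=
    eq_of_subset_of_card_le (insert_subset hi (singleton_subset_iff.2 hj))
      (hcard.trans_eq (card_pair hij).symm)
  rw [← hpair, sum_pair hij, sum_pair hij] at hparity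
  exact mod_add_mod_eq_of_div_parity hp (hshift i hi j hj) hparity

end Translate

/-! ### Burst supports and their syndromes -/

section Positions

variable {N D b p : ℕ}

/-- The residues modulo `p` of the coordinates of a position: the word over `ℤ / p` to which the
inner parity-check matrix is applied. -/
def residues (p : ℕ) (i : Pos N D) : Fin D → ZMod p := fun t => ((i t : ℕ) : ZMod p)

theorem IsCloseL1.symm {i j : Pos N D} (h : IsCloseL1 b i j) : IsCloseL1 b j i := by
  simpa only [IsCloseL1, abs_sub_comm] using h

theorem IsCloseL1.abs_sub_lt {i j : Pos N D} (h : IsCloseL1 b i j) (t : Fin D) :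
    |((i t : ℕ) : ℤ) - (j t : ℕ)| < b :=
  (single_le_sum (f := fun t => |((i t : ℕ) : ℤ) - (j t : ℕ)|) (fun _ _ => abs_nonneg _)
    (mem_univ t)).trans_lt h

theorem LeeDistanceAtLeast.sub_eq_sub {κ : Type*} {A : Matrix κ (Fin D) (ZMod p)}
    (hA : LeeDistanceAtLeast A (2 * b)) {i j i' j' : Pos N D} (hij : IsCloseL1 b i j)
    (hij' : IsCloseL1 b i' j') (hi : A.mulVec (residues p i) = A.mulVec (residues p i'))
    (hj : A.mulVec (residues p j) = A.mulVec (residues p j')) (t : Fin D) :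
    ((i t : ℕ) : ℤ) - (j t : ℕ) = (i' t : ℕ) - (j' t : ℕ) := by
  let c (t : Fin D) : ℤ := (((i t : ℕ) : ℤ) - (j t : ℕ)) - ((i' t : ℕ) - (j' t : ℕ))
  have hc : ∑ t, |c t| < (2 * b : ℕ) := by
    refine (sum_le_sum fun t _ => abs_sub _ _).trans_lt ?_
    rw [sum_add_distrib, two_mul, Nat.cast_add]
    exact add_lt_add hij hij'
  have hAc : A.mulVec (fun t => (c t : ZMod p)) = 0 := by
    have hcast : (fun t => (c t : ZMod p)) =
        (residues p i - residues p j) - (residues p i' - residues p j') := by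
      funext t
      simp [c, residues]
    rw [hcast, Matrix.mulVec_sub, Matrix.mulVec_sub, Matrix.mulVec_sub, hi, hj, sub_self]
  exact sub_eq_zero.1 (congrFun (hA c hc hAc) t)

theorem LeeDistanceAtLeast.eq_of_mulVec_eq {κ : Type*} {A : Matrix κ (Fin D) (ZMod p)}
    (hA : LeeDistanceAtLeast A (2 * b)) {i j : Pos N D} (hij : IsCloseL1 b i j)
    (h : A.mulVec (residues p i) = A.mulVec (residues p j)) : i = j := by
  funext t
  have hsub := hA.sub_eq_sub hij hij.symm h h.symm t
  exact Fin.ext (by omega)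

theorem mulVec_residues_eq_of_pow_syndromeVal_eq [NeZero p] {r : ℕ}
    {A : Matrix (Fin r) (Fin D) (ZMod p)} {G : Type*} [Monoid G] {x : G} (hx : IsOfFinOrder x)
    (hr : p ^ r ≤ orderOf x) {i j : Pos N D} (h : x ^ syndromeVal A i = x ^ syndromeVal A j) :
    A.mulVec (residues p i) = A.mulVec (residues p j) := by
  have hval := eq_of_pow_baseVal_eq hx hr
    (fun _ => abs_natCast_sub_lt (ZMod.val_lt _) (ZMod.val_lt _)) h
  exact funext fun l => ZMod.val_injective p (congrFun hval l)

/-- The sets of error positions of the `2`-weight-limited `b`-bursts in the `L₁` model. -/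
def IsBurstSupport (b : ℕ) (S : Finset (Pos N D)) : Prop :=
  #S ≤ 2 ∧ (S : Set (Pos N D)).Pairwise (IsCloseL1 b)

variable {S T : Finset (Pos N D)}

theorem IsBurstSupport.injOn_mulVec_residues (hS : IsBurstSupport b S) {κ : Type*}
    {A : Matrix κ (Fin D) (ZMod p)} (hA : LeeDistanceAtLeast A (2 * b)) :
    Set.InjOn (fun i : Pos N D => A.mulVec (residues p i)) S := fun i hi j hj h => by
  by_contra hij
  exact hij (hA.eq_of_mulVec_eq (hS.2 hi hj hij) h)

theorem IsBurstSupport.exists_translate [NeZero p] {r : ℕ} {A : Matrix (Fin r) (Fin D) (ZMod p)}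
    (hA : LeeDistanceAtLeast A (2 * b)) {K : Type*} [Field K] [CharP K 2] {x : K}
    (hr : p ^ r ≤ orderOf x) (hS : IsBurstSupport b S) (hT : IsBurstSupport b T)
    (h : ∑ i ∈ S, x ^ syndromeVal A i = ∑ i ∈ T, x ^ syndromeVal A i)
    (h3 : ∑ i ∈ S, x ^ (3 * syndromeVal A i) = ∑ i ∈ T, x ^ (3 * syndromeVal A i)) :
    ∃ g : Pos N D → Pos N D, Set.InjOn g S ∧ S.image g = T ∧
      ∀ i ∈ S, ∀ j ∈ S, ∀ t, (i t : ℕ) + g j t = g i t + j t := by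
  classical
  have hfin : IsOfFinOrder x := orderOf_pos_iff.1 ((pow_pos (NeZero.pos p) r).trans_le hr)
  let f (i : Pos N D) : K := x ^ syndromeVal A i
  have hsyn {i j : Pos N D} (hij : f i = f j) :
      A.mulVec (residues p i) = A.mulVec (residues p j) :=
    mulVec_residues_eq_of_pow_syndromeVal_eq hfin hr hij
  have hinj {U : Finset (Pos N D)} (hU : IsBurstSupport b U) : Set.InjOn f U :=
    fun i hi j hj hij => hU.injOn_mulVec_residues hA hi hj (hsyn hij)
  have himage : S.image f = T.image f := by
    refine image_eq_of_sum_eq_of_sum_cube_eq hS.1 hT.1 (hinj hS) (hinj hT)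
      (fun i => pow_ne_zero _ hfin.isUnit.ne_zero) h ?_
    simpa only [f, ← pow_mul, mul_comm _ 3] using h3
  have hpreimage (i : Pos N D) (hi : i ∈ S) : ∃ j ∈ T, f j = f i :=
    mem_image.1 (himage ▸ mem_image_of_mem f hi)
  choose! g hgT hgf using hpreimage
  have hg : Set.InjOn g S := fun i hi j hj hij =>
    hinj hS hi hj (by rw [← hgf i hi, hij, hgf j hj])
  refine ⟨g, hg, eq_of_subset_of_card_le (image_subset_iff.2 hgT) ?_, fun i hi j hj t => ?_⟩
  · rw [card_image_of_injOn hg, ← card_image_of_injOn (hinj hS), himage,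
      card_image_of_injOn (hinj hT)]
  · obtain rfl | hij := eq_or_ne i j
    · exact add_comm _ _
    have hsub := hA.sub_eq_sub (hS.2 hi hj hij) (hT.2 (hgT i hi) (hgT j hj) (hg.ne hi hj hij))
      (hsyn (hgf i hi).symm) (hsyn (hgf j hj).symm) t
    omega

theorem IsBurstSupport.mod_eq_of_sum_eq [NeZero p] (hS : IsBurstSupport b S) {κ : Type*}
    {A : Matrix κ (Fin D) (ZMod p)} (hA : LeeDistanceAtLeast A (2 * b)) {K : Type*} [Field K]
    [CharP K 2] {x : K} (hx : p ^ D ≤ orderOf x) {g : Pos N D → Pos N D}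
    (hshift : ∀ i ∈ S, ∀ j ∈ S, ∀ t, (i t : ℕ) + g j t = g i t + j t)
    (hparity : ∀ t, ∑ i ∈ S, (((i t : ℕ) / p : ℕ) : ZMod 2) =
      ∑ i ∈ S, (((g i t : ℕ) / p : ℕ) : ZMod 2))
    (h : ∑ i ∈ S, x ^ baseVal p (fun t => (i t : ℕ) % p) =
      ∑ i ∈ S, x ^ baseVal p (fun t => (g i t : ℕ) % p)) {j : Pos N D} (hj : j ∈ S) (t : Fin D) :
    (j t : ℕ) % p = (g j t : ℕ) % p := by
  have hp : 0 < p := NeZero.pos p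
  have hfin : IsOfFinOrder x := orderOf_pos_iff.1 ((pow_pos hp D).trans_le hx)
  have hdigits {i k : Pos N D} (hik : x ^ baseVal p (fun t => (i t : ℕ) % p) =
      x ^ baseVal p (fun t => (k t : ℕ) % p)) (t : Fin D) : (i t : ℕ) % p = (k t : ℕ) % p :=
    congrFun (eq_of_pow_baseVal_eq hfin hx
      (fun _ => abs_natCast_sub_lt (Nat.mod_lt _ hp) (Nat.mod_lt _ hp)) hik) t
  have hinj : Set.InjOn (fun i : Pos N D => x ^ baseVal p fun t => (i t : ℕ) % p) S := by
    intro i hi k hk hik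
    have hres : residues p i = residues p k :=
      funext fun t => (ZMod.natCast_eq_natCast_iff' _ _ p).2 (hdigits hik t)
    exact hS.injOn_mulVec_residues hA hi hk (congrArg A.mulVec hres)
  have hmodshift (i : Pos N D) (hi : i ∈ S) (k : Pos N D) (hk : k ∈ S) (t : Fin D) :
      (i t : ℕ) % p + (g k t : ℕ) % p = (g i t : ℕ) % p + (k t : ℕ) % p :=
    mod_add_mod_eq_of_sum_div_eq hp (u := fun i : Pos N D => (i t : ℕ)) (u' := fun i => g i t)
      hS.1 (fun i hi k hk => hshift i hi k hk t) (hparity t) hi hk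
  exact hdigits (pow_baseVal_eq_of_sum_eq hfin.isUnit.ne_zero hS.1 hinj hmodshift h hj) t

theorem IsBurstSupport.eq_of_sum_pow_baseVal_eq {n : ℕ} [NeZero n] (hn : b ≤ n)
    {S : Finset (Pos (n * p) D)} (hS : IsBurstSupport b S) {K : Type*} [Field K] [CharP K 2]
    {x : K} (hx : n ^ D ≤ orderOf x) (hp : p.Coprime (orderOf x))
    {g : Pos (n * p) D → Pos (n * p) D}
    (hshift : ∀ i ∈ S, ∀ j ∈ S, ∀ t, (i t : ℕ) + g j t = g i t + j t)
    (hmod : ∀ i ∈ S, ∀ t, (i t : ℕ) % p = (g i t : ℕ) % p)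
    (h : ∑ i ∈ S, x ^ baseVal n (fun t => (i t : ℕ)) =
      ∑ i ∈ S, x ^ baseVal n (fun t => (g i t : ℕ))) {j : Pos (n * p) D} (hj : j ∈ S) :
    g j = j := by
  have hfin : IsOfFinOrder x := orderOf_pos_iff.1 ((pow_pos (NeZero.pos n) D).trans_le hx)
  have hinj : Set.InjOn (fun i : Pos (n * p) D => x ^ baseVal n fun t => (i t : ℕ)) S := by
    intro i hi k hk hik
    by_contra hne
    have hclose (t : Fin D) : |((i t : ℕ) : ℤ) - (k t : ℕ)| < n :=
      ((hS.2 hi hk hne).abs_sub_lt t).trans_le (by exact_mod_cast hn)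
    have heq := eq_of_pow_baseVal_eq hfin hx hclose hik
    exact hne (funext fun t => Fin.ext (congrFun heq t))
  have hpow := pow_baseVal_eq_of_sum_eq hfin.isUnit.ne_zero hS.1 hinj hshift h hj
  have heq := eq_of_mod_eq_of_pow_baseVal_eq hfin hx hp (fun t => (j t).isLt)
    (fun t => (g j t).isLt) (hmod j hj) hpow
  exact funext fun t => Fin.ext (congrFun heq t).symm

end Positions

/-! ### The parity checks -/

section ParityChecks

variable {n p D b r : ℕ}

theorem IsBurstSupport.eq_of_sum_layers_eq [NeZero n] [NeZero p] (hn : b ≤ n)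
    {A : Matrix (Fin r) (Fin D) (ZMod p)} (hA : LeeDistanceAtLeast A (2 * b))
    {Kα Kβ Kγ : Type*} [Field Kα] [Field Kβ] [Field Kγ] [CharP Kα 2] [CharP Kβ 2] [CharP Kγ 2]
    {α : Kα} {β : Kβ} {γ : Kγ} (hα : n ^ D ≤ orderOf α) (hαp : p.Coprime (orderOf α))
    (hβ : p ^ r ≤ orderOf β) (hγ : p ^ D ≤ orderOf γ) {S T : Finset (Pos (n * p) D)}
    (hS : IsBurstSupport b S) (hT : IsBurstSupport b T)
    (hsyn : ∑ i ∈ S, β ^ syndromeVal A i = ∑ i ∈ T, β ^ syndromeVal A i)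
    (hsyn3 : ∑ i ∈ S, β ^ (3 * syndromeVal A i) = ∑ i ∈ T, β ^ (3 * syndromeVal A i))
    (hparity : ∀ t, ∑ i ∈ S, (((i t : ℕ) / p : ℕ) : ZMod 2) =
      ∑ i ∈ T, (((i t : ℕ) / p : ℕ) : ZMod 2))
    (hrem : ∑ i ∈ S, γ ^ baseVal p (fun t => (i t : ℕ) % p) =
      ∑ i ∈ T, γ ^ baseVal p (fun t => (i t : ℕ) % p))
    (hpos : ∑ i ∈ S, α ^ baseVal n (fun t => (i t : ℕ)) =
      ∑ i ∈ T, α ^ baseVal n (fun t => (i t : ℕ))) : S = T := by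
  classical
  obtain ⟨g, hg, rfl, hshift⟩ := hS.exists_translate hA hβ hT hsyn hsyn3
  simp only [sum_image hg] at hparity hrem hpos
  have hmod (i : Pos (n * p) D) (hi : i ∈ S) (t : Fin D) : (i t : ℕ) % p = (g i t : ℕ) % p :=
    hS.mod_eq_of_sum_eq hA hγ hshift hparity hrem hi t
  have hfix (i : Pos (n * p) D) (hi : i ∈ S) : g i = i :=
    hS.eq_of_sum_pow_baseVal_eq hn hα hαp hshift hmod hpos hi
  exact (S.image_id.symm.trans (image_congr fun i hi => (hfix i hi).symm))

variable {ι : Type*} [Fintype ι]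

/-- The set of error positions of a binary word. -/
def errorSupport (e : ι → ZMod 2) : Finset ι := {i | e i ≠ 0}

theorem errorSupport_injective : Function.Injective (errorSupport (ι := ι)) := by
  intro e e' h
  funext i
  have hi : e i ≠ 0 ↔ e' i ≠ 0 := by
    simpa only [errorSupport, mem_filter, mem_univ, true_and] using Finset.ext_iff.1 h i
  have hbinary : ∀ x y : ZMod 2, (x ≠ 0 ↔ y ≠ 0) → x = y := by decide
  exact hbinary _ _ hi

theorem sum_smul_eq_sum_errorSupport {V : Type*} [AddCommGroup V] [Module (ZMod 2) V]
    (e : ι → ZMod 2) (X : ι → V) : ∑ i, e i • X i = ∑ i ∈ errorSupport e, X i := by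
  rw [errorSupport, sum_filter]
  refine sum_congr rfl fun i _ => ?_
  split_ifs with hi
  · have hone : e i = 1 := Fin.eq_one_of_ne_zero (e i) hi
    rw [hone, one_smul]
  · rw [not_not.1 hi, zero_smul]

theorem isBurstSupport_errorSupport {N : ℕ} {e : Arr N D} (he : e ∈ burstsL1 N D b) :
    IsBurstSupport b (errorSupport e) := by
  classical
  rcases he with hle | ⟨heq, i, j, hij, hi, hj, hclose⟩
  · exact ⟨hle.trans one_le_two, fun i hi j hj hij => absurd (card_le_one.1 hle i hi j hj) hij⟩
  · have hpair : {i, j} = errorSupport e :=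
      eq_of_subset_of_card_le (by simp [insert_subset_iff, errorSupport, hi, hj])
        (heq.trans (card_pair hij).symm).le
    refine ⟨heq.le, ?_⟩
    rw [← hpair, coe_pair]
    exact Set.pairwise_pair.2 fun _ => ⟨hclose, hclose.symm⟩

theorem sum_smul_eq_zero_of_coordinates {R κ V : Type*} [CommSemiring R] [AddCommMonoid V]
    [Module R V] (Φ : V ≃ₗ[R] (κ → R)) {X : ι → V} {e : ι → R}
    (h : ∀ l, ∑ i, Φ (X i) l * e i = 0) :
    ∑ i, e i • X i = 0 := by
  refine (LinearEquiv.map_eq_zero_iff Φ).1 (funext fun l => ?_)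
  simpa only [map_sum, map_smul, Finset.sum_apply, Pi.smul_apply, smul_eq_mul, Pi.zero_apply,
    mul_comm] using h l

variable {m a a' : ℕ} {A : Matrix (Fin r) (Fin D) (ZMod p)} {α : GaloisField 2 m}
  {β : GaloisField 2 a} {γ : GaloisField 2 a'}

/-- The column of the parity-check matrix at `i`, before the field elements are expanded into
binary entries. -/
noncomputable def columnL1 (A : Matrix (Fin r) (Fin D) (ZMod p)) (α : GaloisField 2 m)
    (β : GaloisField 2 a) (γ : GaloisField 2 a') (i : Pos (n * p) D) :
    GaloisField 2 a × GaloisField 2 a × (Fin D → ZMod 2) × GaloisField 2 a' × GaloisField 2 m :=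
  (β ^ syndromeVal A i, β ^ (3 * syndromeVal A i), fun t => (((i t : ℕ) / p : ℕ) : ZMod 2),
    γ ^ baseVal p (fun t => (i t : ℕ) % p), α ^ baseVal n (fun t => (i t : ℕ)))

theorem sum_smul_columnL1_eq_zero {φm : GaloisField 2 m ≃ₗ[ZMod 2] (Fin m → ZMod 2)}
    {φa : GaloisField 2 a ≃ₗ[ZMod 2] (Fin a → ZMod 2)}
    {φa' : GaloisField 2 a' ≃ₗ[ZMod 2] (Fin a' → ZMod 2)} {e : Arr (n * p) D}
    (he : e ∈ codeOf (parityCheckL1 (n := n) A α β γ φm φa φa')) :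
    ∑ i, e i • columnL1 A α β γ i = 0 := by
  have hrow := congrFun (show (parityCheckL1 (n := n) A α β γ φm φa φa').mulVec e = 0 from he)
  have hsum := sum_smul_eq_zero_of_coordinates φa fun l => hrow (.inl l)
  have hsum3 := sum_smul_eq_zero_of_coordinates φa fun l => hrow (.inr (.inl l))
  have hparity := sum_smul_eq_zero_of_coordinates (LinearEquiv.refl (ZMod 2) (Fin D → ZMod 2))
    (X := fun (i : Pos (n * p) D) t => (((i t : ℕ) / p : ℕ) : ZMod 2))
    fun l => hrow (.inr (.inr (.inl l)))
  have hrem := sum_smul_eq_zero_of_coordinates φa' fun l => hrow (.inr (.inr (.inr (.inl l))))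
  have hpos := sum_smul_eq_zero_of_coordinates φm fun l => hrow (.inr (.inr (.inr (.inr l))))
  simp only [Prod.ext_iff, Prod.fst_sum, Prod.snd_sum]
  exact ⟨hsum, hsum3, hparity, hrem, hpos⟩

theorem eq_of_sub_mem_codeOf [NeZero n] [NeZero p] (hn : b ≤ n)
    (hA : LeeDistanceAtLeast A (2 * b)) (hα : n ^ D ≤ orderOf α) (hαp : p.Coprime (orderOf α))
    (hβ : p ^ r ≤ orderOf β) (hγ : p ^ D ≤ orderOf γ)
    {φm : GaloisField 2 m ≃ₗ[ZMod 2] (Fin m → ZMod 2)}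
    {φa : GaloisField 2 a ≃ₗ[ZMod 2] (Fin a → ZMod 2)}
    {φa' : GaloisField 2 a' ≃ₗ[ZMod 2] (Fin a' → ZMod 2)} {e e' : Arr (n * p) D}
    (he : e ∈ burstsL1 (n * p) D b) (he' : e' ∈ burstsL1 (n * p) D b)
    (hsub : e - e' ∈ codeOf (parityCheckL1 (n := n) A α β γ φm φa φa')) : e = e' := by
  have hcol : ∑ i ∈ errorSupport e, columnL1 A α β γ i =
      ∑ i ∈ errorSupport e', columnL1 A α β γ i := by
    rw [← sub_eq_zero, ← sum_smul_eq_sum_errorSupport, ← sum_smul_eq_sum_errorSupport,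
      ← sum_sub_distrib]
    simpa only [Pi.sub_apply, sub_smul] using sum_smul_columnL1_eq_zero hsub
  simp only [Prod.ext_iff, Prod.fst_sum, Prod.snd_sum, funext_iff, Finset.sum_apply] at hcol
  obtain ⟨hsyn, hsyn3, hparity, hrem, hpos⟩ := hcol
  exact errorSupport_injective <| (isBurstSupport_errorSupport he).eq_of_sum_layers_eq hn hA hα
    hαp hβ hγ (isBurstSupport_errorSupport he') hsyn hsyn3 hparity hrem hpos

end ParityChecks

theorem corrects_of_sub_mem_imp_eq {ι : Type*} {C : Submodule (ZMod 2) (ι → ZMod 2)}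
    {E : Set (ι → ZMod 2)} (h : ∀ e ∈ E, ∀ e' ∈ E, e - e' ∈ C → e = e') : Corrects C E := by
  let received (x : C × E) : ι → ZMod 2 := x.1 + x.2
  let codeword (x : C × E) : ι → ZMod 2 := x.1
  have hfactors : codeword.FactorsThrough received := by
    intro x y (hxy : (x.1 : ι → ZMod 2) + x.2 = y.1 + y.2)
    have hsub : (x.2 : ι → ZMod 2) - y.2 = y.1 - x.1 := by
      linear_combination hxy
    have herr := h x.2 x.2.2 y.2 y.2.2 (hsub ▸ C.sub_mem y.1.2 x.1.2)
    rw [herr] at hxy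
    exact add_right_cancel hxy
  exact ⟨Function.extend received codeword 0, fun c hc e he =>
    hfactors.extend_apply 0 (⟨c, hc⟩, ⟨e, he⟩)⟩

theorem IsPrimitiveElement.orderOf_eq {k : ℕ} (hk : k ≠ 0) {x : GaloisField 2 k}
    (hx : IsPrimitiveElement x) : orderOf x = 2 ^ k - 1 := by
  obtain ⟨u, rfl, hu⟩ := hx
  rw [orderOf_units, orderOf_eq_card_of_forall_mem_zpowers hu, Nat.card_units,
    GaloisField.card 2 k hk]

theorem IsPrimitiveElement.le_orderOf {N k : ℕ} (hk : k = Nat.clog 2 (N + 1))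
    {x : GaloisField 2 k} (hx : IsPrimitiveElement x) : N ≤ orderOf x := by
  rcases N.eq_zero_or_pos with rfl | hN
  · exact Nat.zero_le _
  have hk0 : k ≠ 0 := hk ▸ (Nat.clog_pos one_lt_two (by omega)).ne'
  have hpow : N + 1 ≤ 2 ^ k := hk ▸ Nat.le_pow_clog one_lt_two _
  rw [hx.orderOf_eq hk0]
  omega

end BurstCode

theorem mainTheorem6_general {n b D p r m a a' : ℕ} [NeZero n] [NeZero p] (hn : b ≤ n)
    {A : Matrix (Fin r) (Fin D) (ZMod p)} (hA : BurstCode.LeeDistanceAtLeast A (2 * b))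
    {α : GaloisField 2 m} {β : GaloisField 2 a} {γ : GaloisField 2 a'}
    (hα : n ^ D ≤ orderOf α) (hαp : p.Coprime (orderOf α)) (hβ : p ^ r ≤ orderOf β)
    (hγ : p ^ D ≤ orderOf γ) (φm : GaloisField 2 m ≃ₗ[ZMod 2] (Fin m → ZMod 2))
    (φa : GaloisField 2 a ≃ₗ[ZMod 2] (Fin a → ZMod 2))
    (φa' : GaloisField 2 a' ≃ₗ[ZMod 2] (Fin a' → ZMod 2)) :
    (∃ k : ℕ, BurstCode.HasParameters
      (BurstCode.codeOf (BurstCode.parityCheckL1 (n := n) A α β γ φm φa φa')) ((n * p) ^ D) k) ∧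
      BurstCode.Corrects
        (BurstCode.codeOf (BurstCode.parityCheckL1 (n := n) A α β γ φm φa φa'))
        (BurstCode.burstsL1 (n * p) D b) :=
  ⟨⟨_, by simp, rfl⟩, BurstCode.corrects_of_sub_mem_imp_eq fun _ he _ he' =>
    BurstCode.eq_of_sub_mem_codeOf hn hA hα hαp hβ hγ he he'⟩

theorem mainTheorem6 (n b D p s r m a a' : ℕ)
    (hb : 2 ≤ b) (hn : b ≤ n) (hD : 1 ≤ D)
    [Fact p.Prime] (hp : IsLeast {q : ℕ | q.Prime ∧ 2 * b + 1 ≤ q} p)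
    (hs : s = Nat.clog p (D + 1))
    (ξ : Fin D → GaloisField p s) (hξ : Function.Injective ξ)
    (hr : r = BurstCode.redundancy (BurstCode.bchCode p b ξ))
    (A : Matrix (Fin r) (Fin D) (ZMod p))
    (hA : BurstCode.codeOf A = BurstCode.bchCode p b ξ)
    (hm : m = Nat.clog 2 (n ^ D + 1))
    (ha : a = Nat.clog 2 (p ^ r + 1))
    (ha' : a' = Nat.clog 2 (p ^ D + 1))
    (hgcd : Nat.gcd p (2 ^ m - 1) = 1)
    (α : GaloisField 2 m) (β : GaloisField 2 a) (γ : GaloisField 2 a')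
    (hα : BurstCode.IsPrimitiveElement α) (hβ : BurstCode.IsPrimitiveElement β)
    (hγ : BurstCode.IsPrimitiveElement γ)
    (φm : GaloisField 2 m ≃ₗ[ZMod 2] (Fin m → ZMod 2))
    (φa : GaloisField 2 a ≃ₗ[ZMod 2] (Fin a → ZMod 2))
    (φa' : GaloisField 2 a' ≃ₗ[ZMod 2] (Fin a' → ZMod 2))
    (C : Submodule (ZMod 2) (BurstCode.Arr (n * p) D))
    (hC : C = BurstCode.codeOf (BurstCode.parityCheckL1 (n := n) A α β γ φm φa φa')) :
    (∃ k : ℕ, BurstCode.HasParameters C ((n * p) ^ D) k) ∧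
      BurstCode.Corrects C (BurstCode.burstsL1 (n * p) D b) := by
  subst hC
  have : NeZero n := ⟨by omega⟩
  have hm0 : m ≠ 0 := by
    have hpos : 0 < n ^ D := pow_pos (NeZero.pos n) D
    exact hm ▸ (Nat.clog_pos one_lt_two (by omega)).ne'
  have hlee : BurstCode.LeeDistanceAtLeast A (2 * b) :=
    BurstCode.leeDistanceAtLeast_of_codeOf_eq_bchCode ((Nat.le_succ _).trans hp.1.2) hξ hA
  have hcoprime : p.Coprime (orderOf α) := by rwa [hα.orderOf_eq hm0]
  exact mainTheorem6_general hn hlee (hα.le_orderOf hm) hcoprime (hβ.le_orderOf ha)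
    (hγ.le_orderOf ha') φm φa φa'
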